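/- **Knots.** Let $n\ge 0$ be an integer and let $q\ge 4$ be an integer coprime to $3$, so $q=3k+1$ or $q=3k+2$ with $k\ge 1$. Let $\sigma_1,\sigma_2$ be the standard generators of the $3$-strand braid group (positive crossings). The knot $K_n^{(3,q)}\subset S^3$ is given by the following diagram. Start with the closure of the $3$-braid $(\sigma_1\sigma_2)^{3k}\,\sigma_1\sigma_2\sigma_1\,\sigma_2^{\varepsilon}$, where $\varepsilon=-1$ if $q=3k+1$ and $\varepsilon=+1$ if $q=3k+2$; this is the torus knot $T(3,q)$. Replace the last crossing $\sigma_2^{\varepsilon}$ by a row of $2n+1$ crossings of the same sign $\varepsilon$, in which the two strands are twisted around each other with opposite orientations (so $n$ full twists on two antiparallel strands are added to the crossing; the twists are right-handed if $q=3k+1$ and left-handed if $q=3k+2$). In particular $K_0^{(3,q)}=T(3,q)$. **Determinant.** For a knot $K$ let $\Delta_K(t)\in\mathbb{Z}[t,t^{-1}]$ be its Alexander polynomial, a generator of the first elementary ideal of an Alexander matrix of $K$ (well defined up to multiplication by $\pm t^{j}$), and let $\det(K)=|\Delta_K(-1)|$. **Lemma 4.1.** The determinant of $K_n^{(3,q)}$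 is $$\det\bigl(K_n^{(3,q)}\bigr)=\begin{cases}4n+3 & \text{if } q=3k+1 \text{ and } k \text{ is odd},\\ 4n+1 & \text{if } q=3k+1 \text{ and } k \text{ is even},\\ 4n+1 & \text{if } q=3k+2 \text{ and } k \text{ is odd},\\ 4n+3 & \text{if } q=3k+2 \text{ and } k \text{ is even}.\end{cases}$$ -/

import Mathlib

noncomputable section

namespace KnotDiagram

/-! Oriented knot and link diagrams, cut by horizontal lines into elementary slices and read from
bottom to top. At each level the diagram meets the line in finitely many strands, numbered
`0, 1, 2, …` from left to right, each directed upwards (`true`) or downwards (`false`). -/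

/-- An elementary slice of a diagram: a local minimum, a local maximum, or a crossing.
* `cup i b`: a local minimum is born; its two ends become the strands `i` and `i + 1`. The left
  end is directed upwards iff `b = true`, and the right end has the opposite direction.
* `cap i`: the strands `i` and `i + 1` are joined by a local maximum.
* `cross i b`: the strands `i` and `i + 1` cross each other once. If `b = true`, the strand that
  runs between bottom left and top right is the over-strand; if `b = false`, the one that runs
  between bottom right and top left is. (If both strands are directed upwards, `b = true` is a
  positive crossing, the standard braid generator, and `b = false` is its inverse. A repetition of
  crossings with `b = true` is a right-handed twisting of the two strands around each other.) -/
inductive Slice : Type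
  | cup (i : ℕ) (b : Bool)
  | cap (i : ℕ)
  | cross (i : ℕ) (b : Bool)

/-- The coefficient ring `ℤ[t, t⁻¹]`. -/
abbrev Lam : Type := LaurentPolynomial ℤ

/-- What is known about a diagram after reading it up to some level: the strands that meet this
level (for each one the name of the arc that it belongs to, and its direction), the number `arcs` of
arcs met so far (their names are the numbers below `arcs`), and the relations between the arcs met
so far. A relation `∑ cₐ a = 0` is recorded by its coefficients. -/
structure State : Type where
  strands : List (ℕ × Bool)
  arcs : ℕ
  rels : List (ℕ →₀ Lam)

/-- The state below a diagram. -/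
def State.start : State := ⟨[], 0, []⟩

/-- The Alexander relation at a crossing, `(1 - t) o + t l - r = 0`, where `o` is the over-arc and
`l`, `r` are the arcs to the left and to the right of the directed over-arc. Up to the choice of
conventions it is the abelianized Fox derivative of the Wirtinger relation `o l o⁻¹ = r`. -/
def crossingRel (o l r : ℕ) : ℕ →₀ Lam :=
  Finsupp.single o (1 - LaurentPolynomial.T 1) + Finsupp.single l (LaurentPolynomial.T 1)
    - Finsupp.single r 1

/-- Reading one slice. A cup begins a new arc; at a crossing the over-arc continues and the
under-arc is broken, so that a new arc `S.arcs` begins above the crossing; a cap identifies two arcs.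
The result is `none` if the slice does not fit: if the strands it refers to do not exist, or if it
joins two strands whose directions do not match. -/
def step : Slice → State → Option State
  | .cup i b, S =>
      if i ≤ S.strands.length then
        some ⟨S.strands.take i ++ (S.arcs, b) :: (S.arcs, !b) :: S.strands.drop i,
          S.arcs + 1, S.rels⟩
      else none
  | .cap i, S =>
      match S.strands.drop i with
      | (x, dx) :: (y, dy) :: rest =>
          if dx = !dy then
            some ⟨S.strands.take i ++ rest, S.arcs,
              S.rels ++ [Finsupp.single x 1 - Finsupp.single y 1]⟩
          else none
      | _ => none
  | .cross i true, S =>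
      match S.strands.drop i with
      | (x, dx) :: (y, dy) :: rest =>
          some ⟨S.strands.take i ++ (S.arcs, dy) :: (x, dx) :: rest, S.arcs + 1,
            S.rels ++ [if dx then crossingRel x S.arcs y else crossingRel x y S.arcs]⟩
      | _ => none
  | .cross i false, S =>
      match S.strands.drop i with
      | (x, dx) :: (y, dy) :: rest =>
          some ⟨S.strands.take i ++ (y, dy) :: (S.arcs, dx) :: rest, S.arcs + 1,
            S.rels ++ [if dy then crossingRel y x S.arcs else crossingRel y S.arcs x]⟩
      | _ => none

/-- Reading a list of slices, from bottom to top. -/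
def run : List Slice → State → Option State
  | [], S => some S
  | s :: D, S => (step s S).bind (run D)

/-- The Alexander matrix: one row for each relation, one column for each arc. -/
def alexanderMatrix (S : State) : Matrix (Fin S.rels.length) (Fin S.arcs) Lam :=
  fun r a => (S.rels.get r) (a : ℕ)

/-- The first elementary ideal of a matrix with `g` columns, generated by its minors of
size `g - 1`. -/
def firstElementaryIdeal {m g : ℕ} (A : Matrix (Fin m) (Fin g) Lam) : Ideal Lam :=
  Ideal.span {d | ∃ (r : Fin (g - 1) → Fin m) (c : Fin (g - 1) → Fin g),
    d = (A.submatrix r c).det}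

/-- `D` is a closed, consistently oriented diagram, and `Δ` is an Alexander polynomial of it: a
generator of the first elementary ideal of its Alexander matrix. -/
def IsAlexanderPolynomial (D : List Slice) (Δ : Lam) : Prop :=
  ∃ S : State, run D State.start = some S ∧ S.strands = [] ∧
    firstElementaryIdeal (alexanderMatrix S) = Ideal.span {Δ}

/-- Evaluation of a Laurent polynomial at `t = -1`. -/
def evalNegOne : Lam →+* ℤ := LaurentPolynomial.eval₂ (RingHom.id ℤ) (-1 : ℤˣ)

open Classical in
/-- The determinant `|Δ(-1)|`, where `Δ` is the Alexander polynomial (with the junk value `0` for a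
list of slices that has no Alexander polynomial). -/
def determinant (D : List Slice) : ℕ :=
  if h : ∃ Δ : Lam, IsAlexanderPolynomial D Δ then (evalNegOne h.choose).natAbs else 0

/-- The determinant does not depend on the choice of the Alexander polynomial. -/
theorem determinant_eq {D : List Slice} {Δ : Lam} (h : IsAlexanderPolynomial D Δ) :
    determinant D = (evalNegOne Δ).natAbs := by
  have hex : ∃ Δ : Lam, IsAlexanderPolynomial D Δ := ⟨Δ, h⟩
  rw [determinant, dif_pos hex]
  obtain ⟨S, hS, -, hI⟩ := h
  obtain ⟨S', hS', -, hI'⟩ := hex.choose_spec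
  obtain rfl : S = S' := Option.some.inj (hS.symm.trans hS')
  have hs : Ideal.span {hex.choose} = Ideal.span {Δ} := hI'.symm.trans hI
  apply Nat.dvd_antisymm
  · exact Int.natAbs_dvd_natAbs.mpr
      (map_dvd evalNegOne (Ideal.span_singleton_le_span_singleton.mp hs.symm.le))
  · exact Int.natAbs_dvd_natAbs.mpr
      (map_dvd evalNegOne (Ideal.span_singleton_le_span_singleton.mp hs.le))

/-- The closure of the 3-strand braid `(σ₁σ₂)^(3k) σ₁σ₂σ₁` followed by a twisted band, in this order
from bottom to top:
* the three minima of the braid closure: strands `0, 1, 2` go up through the braid, strands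
  `3, 4, 5` come back down;
* `k` full twists `(σ₁σ₂)³` and one half twist `σ₁σ₂σ₁` on three strands;
* on the second and third strand of the braid, a tangle of `m` crossings: the second strand runs
  upwards into the twist region, the third strand is led over its top by a cap and runs downwards
  through it, and then turns up again at the cup. So the two strands in the twist region have
  opposite directions. For `m = 2n + 1` these are one half twist and `n` full twists, right-handed
  if `b = true` (in the oriented diagram, `m` negative crossings) and left-handed if `b = false`
  (`m` positive crossings);
* the three maxima of the braid closure. -/
def twistedClosure (k m : ℕ) (b : Bool) : List Slice :=
  [.cup 0 true, .cup 1 true, .cup 2 true]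
    ++ (List.replicate (3 * k) [Slice.cross 0 true, Slice.cross 1 true]).flatten
    ++ [.cross 0 true, .cross 1 true, .cross 0 true]
    ++ ([.cup 1 true] ++ List.replicate m (.cross 2 b) ++ [.cap 3])
    ++ [.cap 2, .cap 1, .cap 0]

/-- The knot `K_n^{(3,q)}` for `q` coprime to `3`, with `k = q / 3`: the twists are right-handed if
`q = 3k + 1`, and left-handed if `q = 3k + 2`. For `n = 0` the twist region is a single crossing, which
as a braid is `σ₂⁻¹` or `σ₂`, and the knot is the torus knot `T(3,q)`, the closure of
`(σ₁σ₂)^q`. -/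
def knotK (n q : ℕ) : List Slice :=
  if q % 3 = 1 then twistedClosure (q / 3) (2 * n + 1) true
  else twistedClosure (q / 3) (2 * n + 1) false

end KnotDiagram

end

/-!
At `t = -1` the Alexander relation at a crossing with over-arc `o` and under-arcs `x`, `z` reads
`2 o - x - z = 0`: a homomorphism from the cokernel of the Alexander matrix at `t = -1` to an
abelian group `G` is a (Fox) coloring of the arcs by elements of `G`. So the determinant of a
knot is the order of the group generated by the arcs subject to these relations and to
`arc 0 = 0`, and this group is recognized by its colorings in arbitrary abelian groups.

That the first elementary ideal is principal, with a generator that can be evaluated, holds for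
every closed diagram. The Alexander matrix is square, the entries of each row sum to zero, and the
rows satisfy a linear relation whose coefficients are all units (the weights `± t ^ j` come from the Alexander
numbering of the regions of the plane, see `weight`). Hence all its minors of corank one agree up to
units, and each of them generates the ideal (`firstElementaryIdeal_eq_span_det`). Deleting row `0`
and column `0` amounts to replacing row `0` by the relation `arc 0 = 0`; at `t = -1` the absolute
value of the resulting integer determinant is the order of its cokernel
(`natAbs_det_eq_of_cyclic_quotient`). This gives the criterion `determinant_eq_of_colorings`.

Colorings are followed from bottom to top, slice by slice (`Colored`), with no reference to
the names of the arcs. On three parallel strands colored `x`, `y`, `z` the full twist is the point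
reflection `v ↦ 2 (x - y + z) - v`; it preserves `x - y + z`, so two full twists act trivially and
only the parity of `k` matters. In the twist region the colors of the two strands run through an
arithmetic progression. If the first strand has color `0` and the second color `b`, closing up the
diagram forces the third color to be `2 b` (`k` even) or `0` (`k` odd), and what remains is the
single equation `(4 n + 1) b = 0` or `(4 n + 3) b = 0`.
-/

noncomputable section

namespace KnotDiagram

open Matrix

/-! ### Minors of a matrix with two full dependencies, and determinants as orders of cokernels -/

lemma exists_perm_cons {n : ℕ} {r : Fin n → Fin (n + 1)} (hr : Function.Injective r) :
    ∃ (i : Fin (n + 1)) (e : Equiv.Perm (Fin (n + 1))), e 0 = i ∧ ∀ k, e k.succ = r k := by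
  obtain ⟨i, hi⟩ : ∃ i, i ∉ Set.range r := by
    by_contra! h
    have := Fintype.card_le_of_surjective r (fun i => h i)
    simp at this
  have hinj : Function.Injective (Fin.cons i r : Fin (n + 1) → Fin (n + 1)) :=
    Fin.cons_injective_iff.mpr ⟨hi, hr⟩
  exact ⟨i, Equiv.ofBijective _ (Finite.injective_iff_bijective.mp hinj), by simp, by simp⟩

/-- The minor of `A` on the rows `e 1, …, e n` and the columns `f 1, …, f n`, as the determinant of
a matrix of full size: row `e 0` of `A` is replaced by a unit vector. -/
lemma det_updateRow_single_submatrix {R : Type*} [CommRing R] {n : ℕ}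
    (A : Matrix (Fin (n + 1)) (Fin (n + 1)) R) (e f : Equiv.Perm (Fin (n + 1))) :
    ((A.updateRow (e 0) (Pi.single (f 0) 1)).submatrix e f).det
      = (A.submatrix (fun k : Fin n => e k.succ) (fun k : Fin n => f k.succ)).det := by
  rw [det_succ_row_zero, Finset.sum_eq_single 0]
  · simp only [Fin.val_zero, pow_zero, submatrix_apply, updateRow_self, Pi.single_eq_same,
      one_mul, submatrix_submatrix]
    congr 1
    ext i j
    simp [updateRow_apply]
  · intro j _ hj
    simp [hj]
  · simp

lemma det_submatrix_perm {R : Type*} [CommRing R] {n : ℕ}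
    (A : Matrix (Fin n) (Fin n) R) (e f : Equiv.Perm (Fin n)) :
    ∃ s : ℤˣ, (A.submatrix e f).det = s * A.det := by
  refine ⟨Equiv.Perm.sign e * Equiv.Perm.sign f, ?_⟩
  have : A.submatrix e f = (A.submatrix e id).submatrix id f := rfl
  rw [this, det_permute', det_permute]
  push_cast
  ring

lemma det_updateRow_single_eq {R : Type*} [CommRing R] {n : ℕ} (A : Matrix (Fin n) (Fin n) R)
    (i j : Fin n) :
    (A.updateRow i (Pi.single j 1)).det = (A.updateCol j (Pi.single i 1)).det := by
  rw [← adjugate_apply, ← transpose_apply (adjugate A), adjugate_transpose, adjugate_apply,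
    updateRow_transpose, det_transpose]

/-- If the entries of each row of a square matrix sum to zero and its rows satisfy a linear relation
with unit coefficients, then any two of its cofactors divide each other. -/
lemma dvd_det_updateRow {R : Type*} [CommRing R] [IsDomain R] {n : ℕ}
    (A : Matrix (Fin (n + 1)) (Fin (n + 1)) R) (h1 : A *ᵥ 1 = 0)
    (u : Fin (n + 1) → Rˣ) (hu : (fun i => (u i : R)) ᵥ* A = 0) (i j i' j' : Fin (n + 1)) :
    (A.updateRow i (Pi.single j 1)).det ∣ (A.updateRow i' (Pi.single j' 1)).det := by
  -- cofactors along a row agree: the difference of two is the determinant of a matrix that kills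
  -- the all-ones vector
  have hcol : ∀ i, (A.updateRow i (Pi.single j 1)).det = (A.updateRow i (Pi.single j' 1)).det := by
    intro i
    rw [← sub_eq_zero]
    have h : (A.updateRow i (Pi.single j 1 + (-1 : R) • Pi.single j' 1)).det = 0 := by
      rw [← exists_mulVec_eq_zero_iff]
      refine ⟨1, one_ne_zero, ?_⟩
      ext k
      by_cases hk : k = i
      · subst hk
        simp [mulVec, dotProduct, Finset.sum_add_distrib]
      · simpa [mulVec, updateRow_apply, hk] using congrFun h1 k
    rw [det_updateRow_add, det_updateRow_smul] at h
    rw [sub_eq_add_neg, ← neg_one_mul]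
    exact h
  -- dually, the row vector `u` kills `A` with column `j'` replaced by `u i • e i' - u i' • e i`
  have hadj : (u i : R) * (A.updateRow i' (Pi.single j' 1)).det
      = u i' * (A.updateRow i (Pi.single j' 1)).det := by
    rw [det_updateRow_single_eq, det_updateRow_single_eq]
    have h : ((A.updateCol j' ((u i : R) • Pi.single i' 1 + (-(u i' : R)) • Pi.single i 1))).det
        = 0 := by
      by_cases hii : i = i'
      · subst hii
        rw [← add_smul, add_neg_cancel, zero_smul]
        exact det_eq_zero_of_column_eq_zero j' (by simp)
      rw [← exists_vecMul_eq_zero_iff]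
      refine ⟨fun k => u k, fun h => (u 0).ne_zero (congrFun h 0), ?_⟩
      ext k
      by_cases hk : k = j'
      · subst hk
        simp [vecMul, dotProduct, mul_add, Finset.sum_add_distrib, Pi.single_apply]
        ring
      · simpa [vecMul, dotProduct, updateCol_apply, hk] using congrFun hu k
    rw [det_updateCol_add, det_updateCol_smul, det_updateCol_smul] at h
    linear_combination h
  rw [hcol i]
  refine ⟨↑(u i)⁻¹ * u i', (u i).isUnit.mul_left_cancel ?_⟩
  rw [hadj]
  linear_combination (-(u i' : R) * (A.updateRow i (Pi.single j' 1)).det) * (u i).mul_inv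

/-- A square matrix in which the entries of each row sum to zero and the rows satisfy a linear
relation with unit coefficients has a principal first elementary ideal, generated by any of its cofactors. -/
theorem firstElementaryIdeal_eq_span_det {n : ℕ} (A : Matrix (Fin (n + 1)) (Fin (n + 1)) Lam)
    (h1 : A *ᵥ 1 = 0) (u : Fin (n + 1) → Lamˣ) (hu : (fun i => (u i : Lam)) ᵥ* A = 0)
    (i j : Fin (n + 1)) :
    firstElementaryIdeal A = Ideal.span {(A.updateRow i (Pi.single j 1)).det} := by
  apply le_antisymm
  · refine Ideal.span_le.mpr ?_
    rintro _ ⟨r, c, rfl⟩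
    rw [SetLike.mem_coe, Ideal.mem_span_singleton]
    change Fin n → Fin (n + 1) at r c
    by_cases hr : Function.Injective r
    · by_cases hc : Function.Injective c
      · obtain ⟨i', e, rfl, he⟩ := exists_perm_cons hr
        obtain ⟨j', f, rfl, hf⟩ := exists_perm_cons hc
        obtain rfl : (fun k => e k.succ) = r := funext he
        obtain rfl : (fun k => f k.succ) = c := funext hf
        change _ ∣ (A.submatrix (fun k : Fin n => e k.succ) (fun k : Fin n => f k.succ)).det
        rw [← det_updateRow_single_submatrix A e f]
        obtain ⟨s, hs⟩ := det_submatrix_perm (A.updateRow (e 0) (Pi.single (f 0) 1)) e f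
        rw [hs]
        exact (dvd_det_updateRow A h1 u hu i j _ _).mul_left _
      · simp only [Function.Injective, not_forall] at hc
        obtain ⟨a, b, hab, hne⟩ := hc
        change _ ∣ (A.submatrix r c : Matrix (Fin n) (Fin n) Lam).det
        rw [det_zero_of_column_eq hne (fun k => by simp [hab])]
        exact dvd_zero _
    · simp only [Function.Injective, not_forall] at hr
      obtain ⟨a, b, hab, hne⟩ := hr
      change _ ∣ (A.submatrix r c : Matrix (Fin n) (Fin n) Lam).det
      rw [det_zero_of_row_eq hne (by ext k; simp [hab])]
      exact dvd_zero _
  · rw [Ideal.span_singleton_le_iff_mem]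
    have hadj : (A.updateRow i (Pi.single j 1)).det
        = (-1) ^ (i + j : ℕ) * (A.submatrix i.succAbove j.succAbove).det := by
      rw [← adjugate_apply, adjugate_fin_succ_eq_det_submatrix]
    rw [hadj]
    exact Ideal.mul_mem_left _ _ (Ideal.subset_span ⟨i.succAbove, j.succAbove, rfl⟩)

lemma natAbs_det_eq_card_quotient {n : ℕ} (M : Matrix (Fin n) (Fin n) ℤ) (hM : M.det ≠ 0) :
    M.det.natAbs = Nat.card ((Fin n → ℤ) ⧸ Submodule.span ℤ (Set.range M)) := by
  have hli : LinearIndependent ℤ (fun i => M i) := linearIndependent_rows_of_det_ne_zero hM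
  rw [← Submodule.natAbs_det_basis_change (Pi.basisFun ℤ (Fin n)) _ (Module.Basis.span hli)]
  have : (Subtype.val ∘ (Module.Basis.span hli) : Fin n → Fin n → ℤ) = M := by
    ext i k
    simp [Module.Basis.span_apply]
  rw [this]
  exact congrArg Int.natAbs (Pi.basisFun_det_apply M).symm

/-- A square integer matrix has determinant `± d` if its cokernel is generated by an element killed
by `d` and maps onto `ZMod d`. -/
theorem natAbs_det_eq_of_cyclic_quotient {n d : ℕ} (hd : 0 < d) (M : Matrix (Fin n) (Fin n) ℤ)
    (g : (Fin n → ℤ) ⧸ Submodule.span ℤ (Set.range M)) (hg : d • g = 0)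
    (hcyc : ∀ x, x ∈ AddSubgroup.zmultiples g)
    (φ : ((Fin n → ℤ) ⧸ Submodule.span ℤ (Set.range M)) →+ ZMod d)
    (hφ : Function.Surjective φ) : M.det.natAbs = d := by
  have : NeZero d := ⟨hd.ne'⟩
  -- a vector in the kernel of `M` would be a functional on the cokernel, which is torsion
  have hM : M.det ≠ 0 := by
    rw [Ne, ← exists_mulVec_eq_zero_iff]
    rintro ⟨v, hv, hMv⟩
    obtain ⟨a, ha⟩ := Function.ne_iff.mp hv
    obtain ⟨m, hm⟩ := hcyc (Submodule.Quotient.mk (Pi.single a 1))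
    have hmem : (d : ℤ) • (Pi.single a 1 : Fin n → ℤ) ∈ Submodule.span ℤ (Set.range M) := by
      rw [← Submodule.Quotient.mk_eq_zero, Submodule.Quotient.mk_smul, ← hm]
      simp [smul_comm d m g, hg]
    have hle : Submodule.span ℤ (Set.range M)
        ≤ LinearMap.ker (∑ k, v k • (LinearMap.proj k : (Fin n → ℤ) →ₗ[ℤ] ℤ)) := by
      rw [Submodule.span_le]
      rintro _ ⟨i, rfl⟩
      simpa [mulVec, dotProduct, mul_comm] using congrFun hMv i
    have := hle hmem
    simp [Pi.single_apply, hd.ne'] at this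
    exact ha this
  let ψ : ZMod d →+ (Fin n → ℤ) ⧸ Submodule.span ℤ (Set.range M) :=
    ZMod.lift d ⟨zmultiplesHom _ g, by simpa using hg⟩
  have hψ : Function.Surjective ψ := by
    intro x
    obtain ⟨m, hm⟩ := hcyc x
    exact ⟨m, by simpa [ψ] using hm⟩
  have : Finite ((Fin n → ℤ) ⧸ Submodule.span ℤ (Set.range M)) := Finite.of_surjective ψ hψ
  rw [natAbs_det_eq_card_quotient M hM]
  apply le_antisymm
  · simpa using Nat.card_le_card_of_surjective ψ hψ
  · simpa using Nat.card_le_card_of_surjective φ hφ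

/-! ### Reading one slice -/

/-- The graph of `step`, with the strands displayed around the place where the slice acts. -/
inductive Step : Slice → State → State → Prop
  | cup (P R : List (ℕ × Bool)) (b : Bool) (g : ℕ) (rels : List (ℕ →₀ Lam)) :
      Step (.cup P.length b) ⟨P ++ R, g, rels⟩ ⟨P ++ (g, b) :: (g, !b) :: R, g + 1, rels⟩
  | cap (P R : List (ℕ × Bool)) (x y : ℕ) (d : Bool) (g : ℕ) (rels : List (ℕ →₀ Lam)) :
      Step (.cap P.length) ⟨P ++ (x, !d) :: (y, d) :: R, g, rels⟩
        ⟨P ++ R, g, rels ++ [Finsupp.single x 1 - Finsupp.single y 1]⟩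
  | crossTrue (P R : List (ℕ × Bool)) (x y : ℕ) (dx dy : Bool) (g : ℕ)
      (rels : List (ℕ →₀ Lam)) :
      Step (.cross P.length true) ⟨P ++ (x, dx) :: (y, dy) :: R, g, rels⟩
        ⟨P ++ (g, dy) :: (x, dx) :: R, g + 1,
          rels ++ [if dx then crossingRel x g y else crossingRel x y g]⟩
  | crossFalse (P R : List (ℕ × Bool)) (x y : ℕ) (dx dy : Bool) (g : ℕ)
      (rels : List (ℕ →₀ Lam)) :
      Step (.cross P.length false) ⟨P ++ (x, dx) :: (y, dy) :: R, g, rels⟩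
        ⟨P ++ (y, dy) :: (g, dx) :: R, g + 1,
          rels ++ [if dy then crossingRel y x g else crossingRel y g x]⟩

lemma exists_append_of_drop_eq_cons {α : Type*} {L R : List α} {i : ℕ} {x : α}
    (h : L.drop i = x :: R) : ∃ P : List α, L = P ++ x :: R ∧ P.length = i := by
  refine ⟨L.take i, by rw [← h, List.take_append_drop], ?_⟩
  rw [List.length_take, min_eq_left]
  by_contra! hi
  simp [List.drop_eq_nil_of_le hi.le] at h

lemma Step.of_step {s : Slice} {S S' : State} (h : step s S = some S') : Step s S S' := by
  obtain ⟨L, g, rels⟩ := S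
  match s with
  | .cup i b =>
    simp only [step, Option.ite_none_right_eq_some, Option.some.injEq] at h
    obtain ⟨hi, rfl⟩ := h
    have := Step.cup (L.take i) (L.drop i) b g rels
    rwa [List.take_append_drop, List.length_take, min_eq_left hi] at this
  | .cap i =>
    simp only [step] at h
    split at h
    · rename_i x dx y dy R hd
      obtain ⟨P, rfl, rfl⟩ := exists_append_of_drop_eq_cons hd
      simp only [Option.ite_none_right_eq_some, Option.some.injEq] at h
      obtain ⟨rfl, rfl⟩ := h
      simpa using Step.cap P R x y dy g rels
    · simp at h
  | .cross i true =>
    simp only [step] at h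
    split at h
    · rename_i x dx y dy R hd
      obtain ⟨P, rfl, rfl⟩ := exists_append_of_drop_eq_cons hd
      simp only [Option.some.injEq] at h
      subst h
      simpa using Step.crossTrue P R x y dx dy g rels
    · simp at h
  | .cross i false =>
    simp only [step] at h
    split at h
    · rename_i x dx y dy R hd
      obtain ⟨P, rfl, rfl⟩ := exists_append_of_drop_eq_cons hd
      simp only [Option.some.injEq] at h
      subst h
      simpa using Step.crossFalse P R x y dx dy g rels
    · simp at h

/-! ### The two linear dependencies of the Alexander matrix -/

/-- The combination of the arcs at a level that equals the sum of all relations below it, each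
multiplied by a suitable unit (see `WellFormed.exists_units`). The regions at the level are numbered
from left to right: the leftmost one has number `p`, and the number grows by `1` across a strand
directed upwards and drops by `1` across one directed downwards. A strand has coefficient
`± t ^ (-j)`, where `j` is the number of the region on its left as seen along its direction, with
sign `+` if it is directed upwards and `-` if it is directed downwards. -/
def weight : ℤ → List (ℕ × Bool) → (ℕ →₀ Lam)
  | _, [] => 0
  | p, (x, true) :: R =>
      (LaurentPolynomial.T (-p) : Lam) • Finsupp.single x (1 : Lam) + weight (p + 1) R
  | p, (x, false) :: R =>
      -(LaurentPolynomial.T (1 - p) : Lam) • Finsupp.single x (1 : Lam) + weight (p - 1) R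

/-- Here `q` is the number of the region to the right of the strands `P`. -/
lemma exists_weight_append (p : ℤ) (P : List (ℕ × Bool)) :
    ∃ q, ∀ R, weight p (P ++ R) = weight p P + weight q R := by
  induction P generalizing p with
  | nil => exact ⟨p, by simp [weight]⟩
  | cons s P ih =>
    obtain ⟨x, _ | _⟩ := s
    · obtain ⟨q, hq⟩ := ih (p - 1)
      exact ⟨q, fun R => by simp only [List.cons_append, weight, hq, add_assoc]⟩
    · obtain ⟨q, hq⟩ := ih (p + 1)
      exact ⟨q, fun R => by simp only [List.cons_append, weight, hq, add_assoc]⟩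

lemma weight_cup (p : ℤ) (g : ℕ) (b : Bool) (R : List (ℕ × Bool)) :
    weight p ((g, b) :: (g, !b) :: R) = weight p R := by
  cases b <;> simp [weight]

/-- The unit `t ^ p` of `ℤ[t, t⁻¹]`. -/
def unitT (p : ℤ) : Lamˣ := (LaurentPolynomial.isUnit_T p).unit

@[simp] lemma coe_unitT (p : ℤ) : (unitT p : Lam) = LaurentPolynomial.T p := rfl

lemma exists_weight_cap (p : ℤ) (x y : ℕ) (d : Bool) (R : List (ℕ × Bool)) :
    ∃ v : Lamˣ, weight p R = weight p ((x, !d) :: (y, d) :: R)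
      + (v : Lam) • (Finsupp.single x 1 - Finsupp.single y 1) := by
  cases d
  · refine ⟨-unitT (-p), ?_⟩
    simp only [Bool.not_false, weight, Units.val_neg, coe_unitT, add_sub_cancel_right,
      show 1 - (p + 1) = -p by ring]
    module
  · refine ⟨unitT (1 - p), ?_⟩
    simp only [Bool.not_true, weight, coe_unitT, sub_add_cancel, show -(p - 1) = 1 - p by ring]
    module

lemma T_eq_one_mul (p : ℤ) : (LaurentPolynomial.T p : Lam)
    = LaurentPolynomial.T 1 * LaurentPolynomial.T (p - 1) := by
  rw [← LaurentPolynomial.T_add]; congr 1; ring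

lemma crossingRel_eq_smul (o l r : ℕ) : crossingRel o l r
    = (1 - LaurentPolynomial.T 1 : Lam) • Finsupp.single o (1 : Lam)
      + (LaurentPolynomial.T 1 : Lam) • Finsupp.single l (1 : Lam) - Finsupp.single r 1 := by
  simp [crossingRel]

lemma exists_weight_crossTrue (p : ℤ) (x y z : ℕ) (dx dy : Bool) (R : List (ℕ × Bool)) :
    ∃ v : Lamˣ, weight p ((z, dy) :: (x, dx) :: R) = weight p ((x, dx) :: (y, dy) :: R)
      + (v : Lam) • (if dx then crossingRel x z y else crossingRel x y z) := by
  have h1 := T_eq_one_mul (-p)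
  have h2 := T_eq_one_mul (1 - p)
  have h3 := T_eq_one_mul (2 - p)
  rw [show 1 - p - 1 = -p by ring] at h2
  rw [show 2 - p - 1 = 1 - p by ring] at h3
  refine ⟨if dx then if dy then unitT (-p - 1) else -unitT (-p)
    else if dy then -unitT (-p) else unitT (1 - p), ?_⟩
  cases dx <;> cases dy <;>
    simp only [weight, ↓reduceIte, Bool.false_eq_true, Units.val_neg, coe_unitT,
      crossingRel_eq_smul, show -(p + 1) = -p - 1 by ring, show 1 - (p + 1) = -p by ring,
      show -(p - 1) = 1 - p by ring, show 1 - (p - 1) = 2 - p by ring,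
      show p + 1 - 1 = p by ring, show p - 1 + 1 = p by ring, h3, h2, h1] <;>
    module

lemma exists_weight_crossFalse (p : ℤ) (x y z : ℕ) (dx dy : Bool) (R : List (ℕ × Bool)) :
    ∃ v : Lamˣ, weight p ((y, dy) :: (z, dx) :: R) = weight p ((x, dx) :: (y, dy) :: R)
      + (v : Lam) • (if dy then crossingRel y x z else crossingRel y z x) := by
  have h1 := T_eq_one_mul (-p)
  have h2 := T_eq_one_mul (1 - p)
  have h3 := T_eq_one_mul (2 - p)
  rw [show 1 - p - 1 = -p by ring] at h2
  rw [show 2 - p - 1 = 1 - p by ring] at h3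
  refine ⟨if dx then if dy then -unitT (-p - 1) else unitT (-p)
    else if dy then unitT (-p) else -unitT (1 - p), ?_⟩
  cases dx <;> cases dy <;>
    simp only [weight, ↓reduceIte, Bool.false_eq_true, Units.val_neg, coe_unitT,
      crossingRel_eq_smul, show -(p + 1) = -p - 1 by ring, show 1 - (p + 1) = -p by ring,
      show -(p - 1) = 1 - p by ring, show 1 - (p - 1) = 2 - p by ring,
      show p + 1 - 1 = p by ring, show p - 1 + 1 = p by ring, h3, h2, h1] <;>
    module

/-- The properties of the state that persist while a diagram is read: strands and relations refer
to arcs met so far, there are two strands for each arc in excess of the relations, the coefficients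
of each relation sum to zero, and the relations with unit multipliers add up to the `weight` of
the strands. For a closed diagram the last three say that the Alexander matrix is square and has
the two dependencies required by `firstElementaryIdeal_eq_span_det`. -/
structure WellFormed (S : State) : Prop where
  strands_lt : ∀ s ∈ S.strands, s.1 < S.arcs
  rels_lt : ∀ r ∈ S.rels, ∀ a, S.arcs ≤ a → r a = 0
  two_mul_arcs : 2 * S.arcs = 2 * S.rels.length + S.strands.length
  sum_eq_zero : ∀ r ∈ S.rels, r.sum (fun _ c => c) = 0
  exists_units : ∃ u : ℕ → Lamˣ, ∑ i ∈ Finset.range S.rels.length,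
    (u i : Lam) • S.rels.getD i 0 = weight 0 S.strands

lemma exists_units_append {rels : List (ℕ →₀ Lam)} {w w' r : ℕ →₀ Lam}
    (h : ∃ u : ℕ → Lamˣ, ∑ i ∈ Finset.range rels.length, (u i : Lam) • rels.getD i 0 = w)
    (hw : ∃ v : Lamˣ, w' = w + (v : Lam) • r) :
    ∃ u : ℕ → Lamˣ, ∑ i ∈ Finset.range (rels ++ [r]).length,
      (u i : Lam) • (rels ++ [r]).getD i 0 = w' := by
  obtain ⟨u, rfl⟩ := h
  obtain ⟨v, rfl⟩ := hw
  refine ⟨Function.update u rels.length v, ?_⟩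
  rw [List.length_append, List.length_singleton, Finset.sum_range_succ]
  congr 1
  · refine Finset.sum_congr rfl fun i hi => ?_
    have hi := Finset.mem_range.mp hi
    rw [Function.update_of_ne hi.ne, List.getD_append _ _ _ _ hi]
  · simp

lemma sum_coeff_sub (f g : ℕ →₀ Lam) :
    (f - g).sum (fun _ c => c) = f.sum (fun _ c => c) - g.sum (fun _ c => c) :=
  Finsupp.sum_sub_index (by simp)

lemma crossingRel_sum (o l r : ℕ) : (crossingRel o l r).sum (fun _ c => c) = 0 := by
  rw [crossingRel, sum_coeff_sub, Finsupp.sum_add_index' (by simp) (by simp)]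
  simp only [Finsupp.sum_single_index]
  ring

lemma crossingRel_apply_eq_zero {o l r a : ℕ} (ho : o ≠ a) (hl : l ≠ a) (hr : r ≠ a) :
    crossingRel o l r a = 0 := by
  simp [crossingRel, ho, hl, hr]

lemma WellFormed.of_step {s : Slice} {S S' : State} (h : Step s S S') (hS : WellFormed S) :
    WellFormed S' := by
  obtain ⟨h1, h2, h3, h4, h5⟩ := hS
  cases h with
  | cup P R b g rels =>
    obtain ⟨q, hq⟩ := exists_weight_append 0 P
    refine ⟨?_, fun r hr a ha => h2 r hr a (by simp at ha ⊢; lia), ?_, h4, ?_⟩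
    · simp only [List.mem_append, List.mem_cons] at h1 ⊢
      grind
    · simp at h3 ⊢
      lia
    · simpa only [hq, weight_cup] using h5
  | cap P R x y d g rels =>
    obtain ⟨q, hq⟩ := exists_weight_append 0 P
    refine ⟨?_, ?_, ?_, ?_, ?_⟩
    · simp only [List.mem_append, List.mem_cons] at h1 ⊢
      grind
    · have hx : x < g := h1 (x, !d) (by simp)
      have hy : y < g := h1 (y, d) (by simp)
      simp only [List.mem_append, List.mem_singleton]
      rintro r (hr | rfl) a ha
      · exact h2 r hr a ha
      · rw [Finsupp.sub_apply, Finsupp.single_eq_of_ne (by lia), Finsupp.single_eq_of_ne (by lia),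
          sub_zero]
    · simp at h3 ⊢
      lia
    · simp only [List.mem_append, List.mem_singleton]
      rintro r (hr | rfl)
      · exact h4 r hr
      · simp [sum_coeff_sub]
    · refine exists_units_append h5 ?_
      obtain ⟨v, hv⟩ := exists_weight_cap q x y d R
      exact ⟨v, by simp only [hq, hv, add_assoc]⟩
  | crossTrue P R x y dx dy g rels =>
    obtain ⟨q, hq⟩ := exists_weight_append 0 P
    refine ⟨?_, ?_, ?_, ?_, ?_⟩
    · simp only [List.mem_append, List.mem_cons] at h1 ⊢
      grind
    · have hx : x < g := h1 (x, dx) (by simp)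
      have hy : y < g := h1 (y, dy) (by simp)
      simp only [List.mem_append, List.mem_singleton]
      rintro r (hr | rfl) a ha
      · exact h2 r hr a (by lia)
      · split_ifs <;> exact crossingRel_apply_eq_zero (by lia) (by lia) (by lia)
    · simp at h3 ⊢
      lia
    · simp only [List.mem_append, List.mem_singleton]
      rintro r (hr | rfl)
      · exact h4 r hr
      · split_ifs <;> exact crossingRel_sum _ _ _
    · refine exists_units_append h5 ?_
      obtain ⟨v, hv⟩ := exists_weight_crossTrue q x y g dx dy R
      exact ⟨v, by simp only [hq, hv, add_assoc]⟩
  | crossFalse P R x y dx dy g rels =>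
    obtain ⟨q, hq⟩ := exists_weight_append 0 P
    refine ⟨?_, ?_, ?_, ?_, ?_⟩
    · simp only [List.mem_append, List.mem_cons] at h1 ⊢
      grind
    · have hx : x < g := h1 (x, dx) (by simp)
      have hy : y < g := h1 (y, dy) (by simp)
      simp only [List.mem_append, List.mem_singleton]
      rintro r (hr | rfl) a ha
      · exact h2 r hr a (by lia)
      · split_ifs <;> exact crossingRel_apply_eq_zero (by lia) (by lia) (by lia)
    · simp at h3 ⊢
      lia
    · simp only [List.mem_append, List.mem_singleton]
      rintro r (hr | rfl)
      · exact h4 r hr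
      · split_ifs <;> exact crossingRel_sum _ _ _
    · refine exists_units_append h5 ?_
      obtain ⟨v, hv⟩ := exists_weight_crossFalse q x y g dx dy R
      exact ⟨v, by simp only [hq, hv, add_assoc]⟩

lemma WellFormed.start : WellFormed State.start :=
  ⟨by simp [State.start], by simp [State.start], rfl, by simp [State.start],
    fun _ => 1, by simp [State.start, weight]⟩

lemma run_cons_eq_some {s : Slice} {D : List Slice} {S S' : State} :
    run (s :: D) S = some S' ↔ ∃ S₁, step s S = some S₁ ∧ run D S₁ = some S' := by
  simp [run, Option.bind_eq_some_iff]

lemma WellFormed.of_run {D : List Slice} {S S' : State} (h : run D S = some S')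
    (hS : WellFormed S) : WellFormed S' := by
  induction D generalizing S with
  | nil =>
    obtain rfl : S = S' := by simpa [run] using h
    exact hS
  | cons s D ih =>
    obtain ⟨S₁, h1, h2⟩ := run_cons_eq_some.mp h
    exact ih h2 (hS.of_step (.of_step h1))

/-! ### Colorings of the arcs -/

/-- The value of a relation between arcs at `t = -1`, when the arcs have the values `f`. -/
def relEval {G : Type} [AddCommGroup G] (f : ℕ → G) : (ℕ →₀ Lam) →+ G :=
  Finsupp.liftAddHom fun a => ((smulAddHom ℤ G).flip (f a)).comp evalNegOne.toAddMonoidHom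

section

variable {G : Type} [AddCommGroup G]

lemma relEval_apply (f : ℕ → G) (r : ℕ →₀ Lam) :
    relEval f r = r.sum fun a c => evalNegOne c • f a := rfl

@[simp] lemma relEval_single (f : ℕ → G) (a : ℕ) (c : Lam) :
    relEval f (Finsupp.single a c) = evalNegOne c • f a := by
  simp [relEval_apply]

lemma relEval_smul (f : ℕ → G) (c : Lam) (r : ℕ →₀ Lam) :
    relEval f (c • r) = evalNegOne c • relEval f r := by
  rw [relEval_apply, relEval_apply, Finsupp.sum_smul_index (by simp), Finsupp.smul_sum]
  simp [mul_smul]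

lemma evalNegOne_T_one : evalNegOne (LaurentPolynomial.T 1) = -1 := by
  rw [evalNegOne, LaurentPolynomial.eval₂_T]
  simp

lemma relEval_crossingRel (f : ℕ → G) (o l r : ℕ) :
    relEval f (crossingRel o l r) = (2 : ℤ) • f o - f l - f r := by
  simp only [crossingRel, map_add, map_sub, relEval_single, evalNegOne_T_one, map_one]
  module

lemma sum_eq_sum_fin {r : ℕ →₀ Lam} {N : ℕ} (hr : ∀ a, N ≤ a → r a = 0) (φ : ℕ → Lam → G)
    (hφ : ∀ a, φ a 0 = 0) : r.sum φ = ∑ a : Fin N, φ a (r a) := by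
  rw [Finsupp.sum_of_support_subset r (s := Finset.range N) _ _ (fun a _ => hφ a),
    Finset.sum_range]
  intro a ha
  by_contra h
  exact Finsupp.mem_support_iff.mp ha (hr a (by simpa using h))

/-- `f` satisfies all relations of `S` at `t = -1`: it is a coloring of the arcs met so far. The
values of `f` on other numbers are irrelevant. -/
def IsColoring (f : ℕ → G) (S : State) : Prop :=
  ∀ r ∈ S.rels, relEval f r = 0

end

lemma firstElementaryIdeal_submatrix_cast {m m' g : ℕ} (h : m' = m)
    (A : Matrix (Fin m) (Fin g) Lam) :
    firstElementaryIdeal (A.submatrix (Fin.cast h) id) = firstElementaryIdeal A := by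
  subst h
  rfl

/-- A closed diagram has determinant `d` if every coloring with `f 0 = 0` takes its values in a
cyclic group killed by `d`, and some such coloring in `ZMod d` takes the value `1`. -/
theorem determinant_eq_of_colorings {D : List Slice} {S : State} {d : ℕ} (hd : 0 < d)
    (hrun : run D State.start = some S) (hclosed : S.strands = []) (hpos : 0 < S.arcs)
    (hup : ∀ (G : Type) [AddCommGroup G] (f : ℕ → G), f 0 = 0 → IsColoring f S →
      ∃ g : G, d • g = 0 ∧ ∀ a < S.arcs, f a ∈ AddSubgroup.zmultiples g)
    (hlow : ∃ f : ℕ → ZMod d, f 0 = 0 ∧ IsColoring f S ∧ ∃ a < S.arcs, f a = 1) :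
    determinant D = d := by
  obtain ⟨-, hlt, hcard, hsum, u, hu⟩ := WellFormed.start.of_run hrun
  obtain ⟨strands, arcs, rels⟩ := S
  obtain rfl : strands = [] := hclosed
  obtain ⟨n, rfl⟩ : ∃ n, arcs = n + 1 := Nat.exists_eq_succ_of_ne_zero hpos.ne'
  have hlen : n + 1 = rels.length := by simpa using hcard
  simp only at hlt hsum hu hup hlow
  have hmem : ∀ i : Fin (n + 1), rels.getD i 0 ∈ rels := fun i => by
    rw [List.getD_eq_getElem _ _ (by lia)]
    exact List.getElem_mem _
  -- the Alexander matrix, with its rows and columns indexed by the same type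
  set B : Matrix (Fin (n + 1)) (Fin (n + 1)) Lam := fun i a => rels.getD i 0 a with hB
  have hBA : B = (alexanderMatrix ⟨[], n + 1, rels⟩).submatrix (Fin.cast hlen) id := by
    ext1 i a
    change rels.getD i 0 a = rels.get (Fin.cast hlen i) a
    rw [List.getD_eq_getElem _ _ (by lia)]
    rfl
  have hB1 : B *ᵥ 1 = 0 := by
    ext1 i
    rw [Pi.zero_apply, ← hsum _ (hmem i), sum_eq_sum_fin (hlt _ (hmem i)) _ (fun _ => rfl)]
    simp [mulVec, dotProduct, hB]
  rw [← hlen, Finset.sum_range] at hu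
  have huB : (fun i : Fin (n + 1) => (u i : Lam)) ᵥ* B = 0 := by
    ext1 a
    simpa [vecMul, dotProduct, hB, weight] using DFunLike.congr_fun hu (a : ℕ)
  have hAlex : IsAlexanderPolynomial D (B.updateRow 0 (Pi.single 0 1)).det := by
    refine ⟨_, hrun, rfl, ?_⟩
    rw [← firstElementaryIdeal_eq_span_det B hB1 (fun i => u i) huB, hBA,
      firstElementaryIdeal_submatrix_cast]
  rw [determinant_eq hAlex, RingHom.map_det]
  set M : Matrix (Fin (n + 1)) (Fin (n + 1)) ℤ :=
    evalNegOne.mapMatrix (B.updateRow 0 (Pi.single 0 1)) with hMdef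
  have hM0 : M 0 = Pi.single 0 1 := by
    ext a
    simp [hMdef, Pi.single_apply, apply_ite]
  have hM : ∀ i, i ≠ 0 → ∀ a : Fin (n + 1), M i a = evalNegOne (rels.getD i 0 a) := by
    intro i hi a
    change evalNegOne (B.updateRow 0 _ i a) = _
    rw [updateRow_ne hi]
  -- the arcs themselves, as elements of the cokernel, form the universal coloring with `f 0 = 0`
  let f : ℕ → (Fin (n + 1) → ℤ) ⧸ Submodule.span ℤ (Set.range M) := fun a =>
    if h : a < n + 1 then Submodule.Quotient.mk (Pi.single ⟨a, h⟩ 1) else 0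
  have hfsum : ∀ v : Fin (n + 1) → ℤ,
      (Submodule.Quotient.mk v : (Fin (n + 1) → ℤ) ⧸ Submodule.span ℤ (Set.range M))
        = ∑ a : Fin (n + 1), v a • f a := by
    intro v
    conv_lhs => rw [← Finset.univ_sum_single v]
    rw [← Submodule.mkQ_apply, map_sum]
    refine Finset.sum_congr rfl fun a _ => ?_
    rw [← mul_one (v a), ← smul_eq_mul, Pi.single_smul, map_smul, smul_eq_mul, mul_one,
      show f a = Submodule.Quotient.mk (Pi.single a 1) from dif_pos a.2, Submodule.mkQ_apply]
  have hrow : ∀ i, (Submodule.Quotient.mk (M i) :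
      (Fin (n + 1) → ℤ) ⧸ Submodule.span ℤ (Set.range M)) = 0 := fun i =>
    (Submodule.Quotient.mk_eq_zero _).mpr (Submodule.subset_span ⟨i, rfl⟩)
  have hf0 : f 0 = 0 := by
    rw [← hrow 0, hM0]
    simp [f]
  have hfi : ∀ i : Fin (n + 1), i ≠ 0 → relEval f (rels.getD i 0) = 0 := by
    intro i hi
    rw [relEval_apply, sum_eq_sum_fin (hlt _ (hmem i)) _ (by simp), ← hrow i, hfsum]
    simp [hM i hi]
  have hfcol : ∀ i : Fin (n + 1), relEval f (rels.getD i 0) = 0 := by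
    intro i
    by_cases hi : i = 0
    -- relation `0` is a consequence of the others, by the dependency with unit coefficients
    · have h := congrArg (relEval f) hu
      rw [map_sum, Finset.sum_eq_single i] at h
      · rw [relEval_smul, weight, map_zero] at h
        have hunit : IsUnit (evalNegOne (u i)) := (u i).isUnit.map evalNegOne
        exact (hunit.smul_eq_zero).mp h
      · intro k _ hk
        rw [relEval_smul, hfi k (by rwa [hi] at hk), smul_zero]
      · simp
    · exact hfi i hi
  obtain ⟨g, hg, hcyc⟩ := hup _ f hf0 (by
    intro r hr
    obtain ⟨i, hi, rfl⟩ := List.getElem_of_mem hr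
    have := hfcol ⟨i, by simp only at hi; lia⟩
    rwa [List.getD_eq_getElem _ _ hi] at this)
  obtain ⟨c, hc0, hcol, a, ha, hca⟩ := hlow
  let L : (Fin (n + 1) → ℤ) →ₗ[ℤ] ZMod d := Fintype.linearCombination ℤ fun a : Fin (n + 1) => c a
  have hL : Submodule.span ℤ (Set.range M) ≤ LinearMap.ker L := by
    rw [Submodule.span_le]
    rintro _ ⟨i, rfl⟩
    rw [SetLike.mem_coe, LinearMap.mem_ker, Fintype.linearCombination_apply]
    by_cases hi : i = 0
    · rw [hi, hM0]
      simp [Pi.single_apply, hc0]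
    · rw [← hcol _ (hmem i), relEval_apply, sum_eq_sum_fin (hlt _ (hmem i)) _ (by simp)]
      simp [hM i hi]
  refine natAbs_det_eq_of_cyclic_quotient hd M g hg (fun x => ?_)
    (Submodule.liftQ _ L hL).toAddMonoidHom (fun m => ?_)
  · obtain ⟨v, rfl⟩ := Submodule.Quotient.mk_surjective _ x
    rw [hfsum]
    exact sum_mem fun a _ => zsmul_mem (hcyc a a.2) _
  · obtain ⟨m, rfl⟩ := ZMod.intCast_surjective m
    refine ⟨Submodule.Quotient.mk (Pi.single ⟨a, ha⟩ m), ?_⟩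
    simp [L, hca]

/-! ### Colored strands -/

/-- The strands at a level, with their arcs replaced by the colors of the arcs. -/
def paint {G : Type} (f : ℕ → G) (L : List (ℕ × Bool)) : List (G × Bool) :=
  L.map fun s => (f s.1, s.2)

lemma paint_append {G : Type} (f : ℕ → G) (P R : List (ℕ × Bool)) :
    paint f (P ++ R) = paint f P ++ paint f R :=
  List.map_append

lemma paint_cons {G : Type} (f : ℕ → G) (x : ℕ) (d : Bool) (R : List (ℕ × Bool)) :
    paint f ((x, d) :: R) = (f x, d) :: paint f R := rfl

lemma length_paint {G : Type} (f : ℕ → G) (P : List (ℕ × Bool)) : (paint f P).length = P.length :=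
  List.length_map _

lemma paint_congr {G : Type} {f f' : ℕ → G} {L : List (ℕ × Bool)} (h : ∀ s ∈ L, f' s.1 = f s.1) :
    paint f' L = paint f L :=
  List.map_congr_left fun s hs => by rw [h s hs]

lemma eq_append_of_paint_drop_eq {G : Type} {f : ℕ → G} {L : List (ℕ × Bool)} {i : ℕ}
    {x y : G} {dx dy : Bool}
    {R : List (G × Bool)} (h : (paint f L).drop i = (x, dx) :: (y, dy) :: R) :
    ∃ (P : List (ℕ × Bool)) (a b : ℕ) (R' : List (ℕ × Bool)), L = P ++ (a, dx) :: (b, dy) :: R' ∧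
      P.length = i ∧ f a = x ∧ f b = y ∧ paint f R' = R := by
  rw [paint, ← List.map_drop, List.map_eq_cons_iff] at h
  obtain ⟨⟨a, d⟩, l, hd, ha, hl⟩ := h
  obtain ⟨⟨b, d'⟩, R', rfl, hb, hR⟩ := List.map_eq_cons_iff.mp hl
  simp only [Prod.mk.injEq] at ha hb
  obtain ⟨P, rfl, rfl⟩ := exists_append_of_drop_eq_cons hd
  exact ⟨P, a, b, R', by rw [ha.2, hb.2], rfl, ha.1, hb.1, hR⟩

section

variable {G : Type} [AddCommGroup G]

/-- `Colored D cs L`: the slices `D` close up the strands `L`, given by their colors and directions,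
and there is a coloring of the part of the diagram described by `D` in which `L` are the colors at
its bottom level and `cs` are the colors of its local minima, from bottom to top. -/
def Colored : List Slice → List G → List (G × Bool) → Prop
  | [], cs, L => cs = [] ∧ L = []
  | .cup i b :: D, cs, L => i ≤ L.length ∧
      ∃ g cs', cs = g :: cs' ∧ Colored D cs' (L.take i ++ (g, b) :: (g, !b) :: L.drop i)
  | .cap i :: D, cs, L => ∃ x d R, L.drop i = (x, !d) :: (x, d) :: R ∧ Colored D cs (L.take i ++ R)
  | .cross i true :: D, cs, L => ∃ x dx y dy R, L.drop i = (x, dx) :: (y, dy) :: R ∧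
      Colored D cs (L.take i ++ ((2 : ℤ) • x - y, dy) :: (x, dx) :: R)
  | .cross i false :: D, cs, L => ∃ x dx y dy R, L.drop i = (x, dx) :: (y, dy) :: R ∧
      Colored D cs (L.take i ++ (y, dy) :: ((2 : ℤ) • y - x, dx) :: R)

lemma IsColoring.of_step {f : ℕ → G} {s : Slice} {S S' : State} (h : Step s S S')
    (hf : IsColoring f S') : IsColoring f S := by
  cases h
  case cup => exact hf
  all_goals exact fun r hr => hf r (List.mem_append_left _ hr)

lemma IsColoring.of_run {f : ℕ → G} {D : List Slice} {S S' : State} (h : run D S = some S')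
    (hf : IsColoring f S') : IsColoring f S := by
  induction D generalizing S with
  | nil =>
    obtain rfl : S = S' := by simpa [run] using h
    exact hf
  | cons s D ih =>
    obtain ⟨S₁, h1, h2⟩ := run_cons_eq_some.mp h
    exact (ih h2).of_step (.of_step h1)

lemma isColoring_append_singleton {f : ℕ → G} {L L' : List (ℕ × Bool)} {g g' : ℕ}
    {rels : List (ℕ →₀ Lam)} {r : ℕ →₀ Lam} :
    IsColoring f ⟨L, g, rels ++ [r]⟩ ↔ IsColoring f ⟨L', g', rels⟩ ∧ relEval f r = 0 := by
  simp [IsColoring, or_imp, forall_and]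

lemma relEval_crossing_eq_zero_iff (f : ℕ → G) (o x z : ℕ) (d : Bool) :
    relEval f (if d then crossingRel o z x else crossingRel o x z) = 0
      ↔ f z = (2 : ℤ) • f o - f x := by
  split_ifs
  · rw [relEval_crossingRel, sub_right_comm, sub_eq_zero, eq_comm]
  · rw [relEval_crossingRel, sub_eq_zero, eq_comm]

lemma relEval_crossing_eq_zero_iff' (f : ℕ → G) (o x z : ℕ) (d : Bool) :
    relEval f (if d then crossingRel o x z else crossingRel o z x) = 0
      ↔ f z = (2 : ℤ) • f o - f x := by
  split_ifs
  · rw [relEval_crossingRel, sub_eq_zero, eq_comm]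
  · rw [relEval_crossingRel, sub_right_comm, sub_eq_zero, eq_comm]

/-- A coloring of a closed diagram can be followed from any level on, and its values on the
arcs are generated by those on the arcs below this level and on the later local minima. -/
theorem exists_colored {f : ℕ → G} {D : List Slice} {S S' : State} (hS : WellFormed S)
    (h : run D S = some S') (hcl : S'.strands = []) (hf : IsColoring f S') :
    ∃ cs, Colored D cs (paint f S.strands) ∧ ∀ H : AddSubgroup G, (∀ c ∈ cs, c ∈ H) →
      (∀ a < S.arcs, f a ∈ H) → ∀ a < S'.arcs, f a ∈ H := by
  induction D generalizing S with
  | nil =>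
    obtain rfl : S = S' := by simpa [run] using h
    exact ⟨[], by simp [Colored, paint, hcl], fun H _ h => h⟩
  | cons s D ih =>
    obtain ⟨S₁, h1, h2⟩ := run_cons_eq_some.mp h
    have hstep := Step.of_step h1
    have hlt := hS.strands_lt
    have hS₁ := hS.of_step hstep
    have hf₁ := hf.of_run h2
    obtain ⟨cs, hcs, hH⟩ := ih hS₁ h2
    cases hstep with
    | cup P R b g rels =>
      refine ⟨f g :: cs, ?_, fun H hc ha => hH H (fun c hc' => hc c (by simp [hc'])) ?_⟩
      · simpa [Colored, paint_append, paint_cons, length_paint] using hcs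
      · intro a ha'
        obtain h | rfl : a < g ∨ a = g := by simp only at ha'; lia
        · exact ha a h
        · exact hc _ (by simp)
    | cap P R x y d g rels =>
      obtain ⟨-, hr⟩ := (isColoring_append_singleton (L' := []) (g' := 0)).mp hf₁
      have hxy : f x = f y := by simpa [sub_eq_zero] using hr
      refine ⟨cs, ?_, fun H hc ha => hH H hc ha⟩
      simpa [Colored, paint_append, paint_cons, length_paint, hxy] using hcs
    | crossTrue P R x y dx dy g rels =>
      obtain ⟨-, hr⟩ := (isColoring_append_singleton (L' := []) (g' := 0)).mp hf₁
      rw [relEval_crossing_eq_zero_iff] at hr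
      refine ⟨cs, ?_, fun H hc ha => hH H hc ?_⟩
      · refine ⟨f x, dx, f y, dy, paint f R, ?_, ?_⟩
        · simp [paint_append, paint_cons, length_paint]
        · simpa [paint_append, paint_cons, length_paint, hr] using hcs
      · intro a ha'
        obtain h | rfl : a < g ∨ a = g := by simp only at ha'; lia
        · exact ha a h
        · rw [hr]
          exact sub_mem (zsmul_mem (ha _ (hlt (x, dx) (by simp))) _) (ha _ (hlt (y, dy) (by simp)))
    | crossFalse P R x y dx dy g rels =>
      obtain ⟨-, hr⟩ := (isColoring_append_singleton (L' := []) (g' := 0)).mp hf₁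
      rw [relEval_crossing_eq_zero_iff'] at hr
      refine ⟨cs, ?_, fun H hc ha => hH H hc ?_⟩
      · refine ⟨f x, dx, f y, dy, paint f R, ?_, ?_⟩
        · simp [paint_append, paint_cons, length_paint]
        · simpa [paint_append, paint_cons, length_paint, hr] using hcs
      · intro a ha'
        obtain h | rfl : a < g ∨ a = g := by simp only at ha'; lia
        · exact ha a h
        · rw [hr]
          exact sub_mem (zsmul_mem (ha _ (hlt (y, dy) (by simp))) _) (ha _ (hlt (x, dx) (by simp)))

lemma relEval_congr {f f' : ℕ → G} {r : ℕ →₀ Lam} {N : ℕ} (hr : ∀ a, N ≤ a → r a = 0)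
    (h : ∀ a < N, f' a = f a) : relEval f' r = relEval f r := by
  rw [relEval_apply, relEval_apply]
  refine Finsupp.sum_congr fun a ha => ?_
  rw [h a]
  by_contra! hN
  exact Finsupp.mem_support_iff.mp ha (hr a hN)

lemma Step.step_eq {s : Slice} {S S' : State} (h : Step s S S') : step s S = some S' := by
  cases h <;> simp [step]

/-- Conversely, if colors match from level to level, then the slices fit together to a closed
diagram, and the colors come from a coloring of its arcs. -/
theorem exists_run_of_colored {f : ℕ → G} {D : List Slice} {S : State} {cs : List G}
    (hS : WellFormed S) (hf : IsColoring f S) (h : Colored D cs (paint f S.strands)) :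
    ∃ (S' : State) (f' : ℕ → G), run D S = some S' ∧ S'.strands = [] ∧ IsColoring f' S' ∧
      S.arcs ≤ S'.arcs ∧ (∀ a < S.arcs, f' a = f a) ∧ ∀ c ∈ cs, ∃ a < S'.arcs, f' a = c := by
  induction D generalizing S f cs with
  | nil =>
    obtain ⟨rfl, hL⟩ := h
    exact ⟨S, f, rfl, by simpa [paint] using hL, hf, le_rfl, fun _ _ => rfl, by simp⟩
  | cons s D ih =>
    -- it suffices to extend the coloring over the first slice
    suffices hs : ∃ (S₁ : State) (f₁ : ℕ → G) (cs₁ : List G), Step s S S₁ ∧ IsColoring f₁ S₁ ∧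
        S.arcs ≤ S₁.arcs ∧ (∀ a < S.arcs, f₁ a = f a) ∧ Colored D cs₁ (paint f₁ S₁.strands) ∧
        ∀ c ∈ cs, c ∈ cs₁ ∨ ∃ a < S₁.arcs, f₁ a = c by
      obtain ⟨S₁, f₁, cs₁, hstep, hf₁, hle, hagree, hcol, hcs⟩ := hs
      obtain ⟨S', f', hrun, hcl, hf', hle', hagree', hcs'⟩ := ih (hS.of_step hstep) hf₁ hcol
      refine ⟨S', f', run_cons_eq_some.mpr ⟨S₁, hstep.step_eq, hrun⟩, hcl, hf', hle.trans hle',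
        fun a ha => (hagree' a (ha.trans_le hle)).trans (hagree a ha), fun c hc => ?_⟩
      obtain hc | ⟨a, ha, rfl⟩ := hcs c hc
      · exact hcs' c hc
      · exact ⟨a, ha.trans_le hle', hagree' a ha⟩
    obtain ⟨L, g, rels⟩ := S
    have hlt := hS.strands_lt
    have hrels := hS.rels_lt
    simp only at hlt hrels h
    -- the extension of the coloring by the value `z` on the new arc
    have hagree : ∀ z, ∀ a < g, Function.update f g z a = f a := fun z a ha =>
      Function.update_of_ne ha.ne _ _
    have hpaint : ∀ z P, (∀ s ∈ P, s ∈ L) → paint (Function.update f g z) P = paint f P :=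
      fun z P hP => paint_congr fun s hs => hagree z _ (hlt s (hP s hs))
    have hext : ∀ z L' g', IsColoring (Function.update f g z) ⟨L', g', rels⟩ :=
        fun z L' g' r hr => by
      rw [relEval_congr (hrels r hr) (hagree z), hf r hr]
    match s with
    | .cup i b =>
      obtain ⟨hi, z, cs', rfl, hcol⟩ := h
      rw [length_paint] at hi
      refine ⟨_, Function.update f g z, cs',
        by simpa [hi] using Step.cup (L.take i) (L.drop i) b g rels, hext z _ _, by simp, hagree z,
        ?_, ?_⟩
      · rw [paint_append, paint_cons, paint_cons, hpaint z _ fun _ => List.mem_of_mem_take,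
          hpaint z _ fun _ => List.mem_of_mem_drop, Function.update_self]
        simpa [paint, List.map_take, List.map_drop] using hcol
      · intro c hc
        obtain rfl | hc := List.mem_cons.mp hc
        · exact Or.inr ⟨g, by simp, by simp⟩
        · exact Or.inl hc
    | .cap i =>
      obtain ⟨x, d, R, hd, hcol⟩ := h
      obtain ⟨P, a, b, R, rfl, rfl, hab, rfl, rfl⟩ := eq_append_of_paint_drop_eq hd
      refine ⟨_, f, cs, .cap P R a b d g rels, ?_, le_rfl, fun _ _ => rfl, ?_,
        fun c hc => Or.inl hc⟩
      · exact (isColoring_append_singleton (L' := _) (g' := _)).mpr ⟨hf, by simp [hab]⟩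
      · simpa [paint_append, length_paint] using hcol
    | .cross i true =>
      obtain ⟨x, dx, y, dy, R, hd, hcol⟩ := h
      obtain ⟨P, a, b, R, rfl, rfl, rfl, rfl, rfl⟩ := eq_append_of_paint_drop_eq hd
      have ha : a < g := hlt (a, dx) (by simp)
      have hb : b < g := hlt (b, dy) (by simp)
      refine ⟨_, Function.update f g ((2 : ℤ) • f a - f b), cs, .crossTrue P R a b dx dy g rels, ?_,
        by simp, hagree _, ?_, fun c hc => Or.inl hc⟩
      · refine (isColoring_append_singleton (L' := []) (g' := 0)).mpr ⟨hext _ _ _, ?_⟩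
        rw [relEval_crossing_eq_zero_iff, Function.update_self, hagree _ a ha, hagree _ b hb]
      · simp only [paint_append, paint_cons, Function.update_self]
        rw [hpaint _ P (by simp +contextual), hpaint _ R (by simp +contextual), hagree _ a ha]
        simpa [paint_append, length_paint] using hcol
    | .cross i false =>
      obtain ⟨x, dx, y, dy, R, hd, hcol⟩ := h
      obtain ⟨P, a, b, R, rfl, rfl, rfl, rfl, rfl⟩ := eq_append_of_paint_drop_eq hd
      have ha : a < g := hlt (a, dx) (by simp)
      have hb : b < g := hlt (b, dy) (by simp)
      refine ⟨_, Function.update f g ((2 : ℤ) • f b - f a), cs,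
        .crossFalse P R a b dx dy g rels, ?_,
        by simp, hagree _, ?_, fun c hc => Or.inl hc⟩
      · refine (isColoring_append_singleton (L' := []) (g' := 0)).mpr ⟨hext _ _ _, ?_⟩
        rw [relEval_crossing_eq_zero_iff', Function.update_self, hagree _ a ha, hagree _ b hb]
      · simp only [paint_append, paint_cons, Function.update_self]
        rw [hpaint _ P (by simp +contextual), hpaint _ R (by simp +contextual), hagree _ b hb]
        simpa [paint_append, length_paint] using hcol

end

/-- `determinant_eq_of_colorings` in terms of colored strands: the first local minimum is given the
color `0`. -/
theorem determinant_eq_of_colored {b : Bool} {D : List Slice} {d : ℕ} (hd : 0 < d)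
    (hup : ∀ (G : Type) [AddCommGroup G] (cs : List G), Colored D cs [(0, b), (0, !b)] →
      ∃ g : G, d • g = 0 ∧ ∀ c ∈ cs, c ∈ AddSubgroup.zmultiples g)
    (hlow : ∃ cs : List (ZMod d), Colored D cs [(0, b), (0, !b)] ∧ 1 ∈ cs) :
    determinant (.cup 0 b :: D) = d := by
  set S₁ : State := ⟨[(0, b), (0, !b)], 1, []⟩ with hS₁
  have hstep : Step (.cup 0 b) State.start S₁ := Step.cup [] [] b 0 []
  have hwf := WellFormed.start.of_step hstep
  obtain ⟨cs, hcs, h1⟩ := hlow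
  obtain ⟨S, c, hrun, hcl, hc, hle, hagree, hmem⟩ :=
    exists_run_of_colored (f := fun _ => 0) hwf (by simp [IsColoring, hS₁]) hcs
  refine determinant_eq_of_colorings hd (run_cons_eq_some.mpr ⟨S₁, hstep.step_eq, hrun⟩) hcl hle
    (fun G _ f hf0 hf => ?_) ⟨c, hagree 0 (by simp [hS₁]), hc, hmem 1 h1⟩
  obtain ⟨cs, hcs, hH⟩ := exists_colored hwf hrun hcl hf
  simp only [hS₁, paint, List.map_cons, List.map_nil, hf0] at hcs
  obtain ⟨g, hg, hgen⟩ := hup G cs hcs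
  refine ⟨g, hg, hH _ hgen fun a ha => ?_⟩
  obtain rfl : a = 0 := by simpa [hS₁] using ha
  rw [hf0]
  exact zero_mem _

/-! ### Colorings of a twisted closure -/

section

variable {G : Type} [AddCommGroup G] {D : List Slice} {cs : List G} {R : List (G × Bool)}

lemma colored_crossTrue_iff (P : List (G × Bool)) (x y : G) (dx dy : Bool) :
    Colored (.cross P.length true :: D) cs (P ++ (x, dx) :: (y, dy) :: R)
      ↔ Colored D cs (P ++ ((2 : ℤ) • x - y, dy) :: (x, dx) :: R) := by
  constructor
  · rintro ⟨x', dx', y', dy', R', hd, h⟩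
    simp only [List.drop_left, List.cons.injEq, Prod.mk.injEq] at hd
    obtain ⟨⟨rfl, rfl⟩, ⟨rfl, rfl⟩, rfl⟩ := hd
    simpa using h
  · intro h
    exact ⟨x, dx, y, dy, R, by simp, by simpa using h⟩

lemma colored_crossFalse_iff (P : List (G × Bool)) (x y : G) (dx dy : Bool) :
    Colored (.cross P.length false :: D) cs (P ++ (x, dx) :: (y, dy) :: R)
      ↔ Colored D cs (P ++ (y, dy) :: ((2 : ℤ) • y - x, dx) :: R) := by
  constructor
  · rintro ⟨x', dx', y', dy', R', hd, h⟩
    simp only [List.drop_left, List.cons.injEq, Prod.mk.injEq] at hd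
    obtain ⟨⟨rfl, rfl⟩, ⟨rfl, rfl⟩, rfl⟩ := hd
    simpa using h
  · intro h
    exact ⟨x, dx, y, dy, R, by simp, by simpa using h⟩

lemma colored_congr {L L' : List (G × Bool)} (h : L = L') : Colored D cs L ↔ Colored D cs L' := by
  rw [h]

lemma colored_cross_zero_iff (x y : G × Bool) :
    Colored (.cross 0 true :: D) cs (x :: y :: R)
      ↔ Colored D cs (((2 : ℤ) • x.1 - y.1, y.2) :: x :: R) :=
  colored_crossTrue_iff [] _ _ _ _

lemma colored_cross_one_iff (p x y : G × Bool) :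
    Colored (.cross 1 true :: D) cs (p :: x :: y :: R)
      ↔ Colored D cs (p :: ((2 : ℤ) • x.1 - y.1, y.2) :: x :: R) :=
  colored_crossTrue_iff [p] _ _ _ _

/-- The full twist on three strands acts on the colors as a point reflection. -/
lemma colored_fullTwist_iff (x y z : G) (d : Bool) :
    Colored ((List.replicate 3 [Slice.cross 0 true, Slice.cross 1 true]).flatten ++ D) cs
        ((x, d) :: (y, d) :: (z, d) :: R)
      ↔ Colored D cs (((2 : ℤ) • (x - y + z) - x, d) :: ((2 : ℤ) • (x - y + z) - y, d) ::
        ((2 : ℤ) • (x - y + z) - z, d) :: R) := by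
  simp only [List.replicate, List.flatten_cons, List.flatten_nil, List.cons_append, List.nil_append,
    List.append_nil, colored_cross_zero_iff, colored_cross_one_iff]
  apply colored_congr
  simp only [List.cons.injEq, Prod.mk.injEq, and_true]
  exact ⟨by module, by module, by module⟩

lemma colored_fullTwists_even_iff (x y z : G) (d : Bool) (j : ℕ) :
    Colored ((List.replicate (3 * (2 * j)) [Slice.cross 0 true, Slice.cross 1 true]).flatten ++ D)
      cs ((x, d) :: (y, d) :: (z, d) :: R) ↔ Colored D cs ((x, d) :: (y, d) :: (z, d) :: R) := by
  induction j with
  | zero => simp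
  | succ j ih =>
    rw [show 3 * (2 * (j + 1)) = 3 + (3 + 3 * (2 * j)) by ring, List.replicate_add,
      List.replicate_add, List.flatten_append, List.flatten_append, List.append_assoc,
      List.append_assoc, colored_fullTwist_iff, colored_fullTwist_iff, ← ih]
    apply colored_congr
    simp only [List.cons.injEq, Prod.mk.injEq, and_true]
    exact ⟨by module, by module, by module⟩

lemma colored_fullTwists_odd_iff (x y z : G) (d : Bool) (j : ℕ) :
    Colored ((List.replicate (3 * (2 * j + 1)) [Slice.cross 0 true, Slice.cross 1 true]).flatten
        ++ D) cs ((x, d) :: (y, d) :: (z, d) :: R)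
      ↔ Colored D cs (((2 : ℤ) • (x - y + z) - x, d) :: ((2 : ℤ) • (x - y + z) - y, d) ::
        ((2 : ℤ) • (x - y + z) - z, d) :: R) := by
  rw [show 3 * (2 * j + 1) = 3 * (2 * j) + 3 by ring, List.replicate_add, List.flatten_append,
    List.append_assoc, colored_fullTwists_even_iff, colored_fullTwist_iff]

lemma colored_halfTwist_iff (x y z : G) (d : Bool) :
    Colored (.cross 0 true :: .cross 1 true :: .cross 0 true :: D) cs
        ((x, d) :: (y, d) :: (z, d) :: R)
      ↔ Colored D cs
        (((2 : ℤ) • x - (2 : ℤ) • y + z, d) :: ((2 : ℤ) • x - y, d) :: (x, d) :: R) := by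
  simp only [colored_cross_zero_iff, colored_cross_one_iff]
  apply colored_congr
  simp only [List.cons.injEq, Prod.mk.injEq, and_true]
  module

lemma colored_twists_true_iff (p r : G × Bool) (x y : G) (d d' : Bool) (n : ℕ) :
    Colored (List.replicate (2 * n + 1) (.cross 2 true) ++ D) cs
        (p :: r :: (x, d) :: (y, d') :: R)
      ↔ Colored D cs (p :: r :: (x + (2 * n + 1 : ℤ) • (x - y), d') ::
        (x + (2 * n : ℤ) • (x - y), d) :: R) := by
  induction n generalizing x y with
  | zero =>
    refine (colored_crossTrue_iff [p, r] x y d d').trans ?_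
    apply colored_congr
    simp only [List.cons_append, List.nil_append, Nat.cast_zero, List.cons.injEq, Prod.mk.injEq,
      and_true, true_and]
    exact ⟨by module, by module⟩
  | succ n ih =>
    rw [show 2 * (n + 1) + 1 = (2 * n + 1) + 1 + 1 by ring, List.replicate_succ,
      List.replicate_succ, List.cons_append, List.cons_append]
    refine (colored_crossTrue_iff [p, r] _ _ _ _).trans
      ((colored_crossTrue_iff [p, r] _ _ _ _).trans ((ih _ _).trans ?_))
    apply colored_congr
    push_cast
    simp only [List.cons.injEq, Prod.mk.injEq, and_true, true_and]
    exact ⟨by module, by module⟩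

lemma colored_twists_false_iff (p r : G × Bool) (x y : G) (d d' : Bool) (n : ℕ) :
    Colored (List.replicate (2 * n + 1) (.cross 2 false) ++ D) cs
        (p :: r :: (x, d) :: (y, d') :: R)
      ↔ Colored D cs (p :: r :: (x + (2 * n + 1 : ℤ) • (y - x), d') ::
        (x + (2 * n + 2 : ℤ) • (y - x), d) :: R) := by
  induction n generalizing x y with
  | zero =>
    refine (colored_crossFalse_iff [p, r] x y d d').trans ?_
    apply colored_congr
    simp only [List.cons_append, List.nil_append, Nat.cast_zero, List.cons.injEq, Prod.mk.injEq,
      and_true, true_and]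
    exact ⟨by module, by module⟩
  | succ n ih =>
    rw [show 2 * (n + 1) + 1 = (2 * n + 1) + 1 + 1 by ring, List.replicate_succ,
      List.replicate_succ, List.cons_append, List.cons_append]
    refine (colored_crossFalse_iff [p, r] _ _ _ _).trans
      ((colored_crossFalse_iff [p, r] _ _ _ _).trans ((ih _ _).trans ?_))
    apply colored_congr
    push_cast
    simp only [List.cons.injEq, Prod.mk.injEq, and_true, true_and]
    exact ⟨by module, by module⟩

lemma colored_caps_iff (x e u v z c b a : G) :
    Colored [.cap 3, .cap 2, .cap 1, .cap 0] cs [(x, true), (e, true), (u, true), (v, false),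
        (z, true), (c, false), (b, false), (a, false)]
      ↔ cs = [] ∧ z = v ∧ u = c ∧ e = b ∧ x = a := by
  simp [Colored]
  grind

lemma colored_cup_one_iff (p : G × Bool) (L : List (G × Bool)) (b : Bool) :
    Colored (.cup 1 b :: D) cs (p :: L)
      ↔ ∃ g cs', cs = g :: cs' ∧ Colored D cs' (p :: (g, b) :: (g, !b) :: L) := by
  simp [Colored]

lemma colored_cups_iff (a : G) :
    Colored (.cup 1 true :: .cup 2 true :: D) cs [(a, true), (a, false)]
      ↔ ∃ b c cs', cs = b :: c :: cs' ∧ Colored D cs' [(a, true), (b, true), (c, true), (c, false),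
        (b, false), (a, false)] := by
  simp [Colored]

lemma twistedClosure_eq_cons (k m : ℕ) (b : Bool) : twistedClosure k m b =
    .cup 0 true :: .cup 1 true :: .cup 2 true ::
      ((List.replicate (3 * k) [Slice.cross 0 true, Slice.cross 1 true]).flatten ++
        .cross 0 true :: .cross 1 true :: .cross 0 true :: .cup 1 true ::
          (List.replicate m (.cross 2 b) ++ [.cap 3, .cap 2, .cap 1, .cap 0])) := by
  simp [twistedClosure]

/-- The right-handed twisted band and the final maxima: the strands close up iff the cup of the
band has the color `b` of the second maximum and the colors at its two ends match. -/
lemma colored_band_true_iff (x y z c b a : G) (n : ℕ) :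
    Colored (.cup 1 true :: (List.replicate (2 * n + 1) (.cross 2 true) ++
        [.cap 3, .cap 2, .cap 1, .cap 0])) cs
        [(x, true), (y, true), (z, true), (c, false), (b, false), (a, false)]
      ↔ cs = [b] ∧ x = a ∧ z = b + (2 * n : ℤ) • (b - y) ∧ c = b + (2 * n + 1 : ℤ) • (b - y) := by
  simp only [colored_cup_one_iff, Bool.not_true, colored_twists_true_iff, colored_caps_iff]
  constructor
  · rintro ⟨g, _, rfl, rfl, hz, hc, rfl, hx⟩
    exact ⟨rfl, hx, hz, hc.symm⟩
  · rintro ⟨rfl, hx, hz, hc⟩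
    exact ⟨b, [], rfl, rfl, hz, hc.symm, rfl, hx⟩

/-- The left-handed counterpart of `colored_band_true_iff`. -/
lemma colored_band_false_iff (x y z c b a : G) (n : ℕ) :
    Colored (.cup 1 true :: (List.replicate (2 * n + 1) (.cross 2 false) ++
        [.cap 3, .cap 2, .cap 1, .cap 0])) cs
        [(x, true), (y, true), (z, true), (c, false), (b, false), (a, false)]
      ↔ cs = [b] ∧ x = a ∧ z = b + (2 * n + 2 : ℤ) • (y - b) ∧
        c = b + (2 * n + 1 : ℤ) • (y - b) := by
  simp only [colored_cup_one_iff, Bool.not_true, colored_twists_false_iff, colored_caps_iff]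
  constructor
  · rintro ⟨g, _, rfl, rfl, hz, hc, rfl, hx⟩
    exact ⟨rfl, hx, hz, hc.symm⟩
  · rintro ⟨rfl, hx, hz, hc⟩
    exact ⟨b, [], rfl, rfl, hz, hc.symm, rfl, hx⟩

end

/-- A twisted closure has determinant `d` if its colorings with `0` on the first strand are those
with a color `b` killed by `d` on the second strand and on the cup of the band, and `e • b` on the
third strand. -/
lemma determinant_twistedClosure_eq {k m d : ℕ} {s : Bool} (e : ℤ) (hd : 0 < d)
    (h : ∀ (G : Type) [AddCommGroup G] (cs : List G) (b c : G),
      Colored ((List.replicate (3 * k) [Slice.cross 0 true, Slice.cross 1 true]).flatten ++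
        .cross 0 true :: .cross 1 true :: .cross 0 true :: .cup 1 true ::
          (List.replicate m (.cross 2 s) ++ [.cap 3, .cap 2, .cap 1, .cap 0])) cs
        [(0, true), (b, true), (c, true), (c, false), (b, false), (0, false)]
        ↔ cs = [b] ∧ (d : ℤ) • b = 0 ∧ c = e • b) :
    determinant (twistedClosure k m s) = d := by
  rw [twistedClosure_eq_cons]
  refine determinant_eq_of_colored hd (fun G _ cs hcs => ?_) ⟨[1, e • 1, 1], ?_, by simp⟩
  · obtain ⟨b, c, cs, rfl, hcol⟩ := (colored_cups_iff _).mp hcs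
    obtain ⟨rfl, hb, rfl⟩ := (h G _ b c).mp hcol
    have hmem := AddSubgroup.mem_zmultiples b
    refine ⟨b, by rwa [natCast_zsmul] at hb, fun c hc => ?_⟩
    simp only [List.mem_cons, List.not_mem_nil, or_false] at hc
    obtain rfl | rfl | rfl := hc
    exacts [hmem, zsmul_mem hmem e, hmem]
  · exact (colored_cups_iff _).mpr ⟨1, e • 1, [1], rfl, (h _ _ _ _).mpr ⟨rfl, by simp, rfl⟩⟩

lemma determinant_twistedClosure_odd_true (j n : ℕ) :
    determinant (twistedClosure (2 * j + 1) (2 * n + 1) true) = 4 * n + 3 := by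
  refine determinant_twistedClosure_eq 0 (by lia) fun G _ cs b c => ?_
  rw [colored_fullTwists_odd_iff, colored_halfTwist_iff, colored_band_true_iff]
  push_cast
  refine and_congr_right fun _ => ⟨?_, ?_⟩
  · rintro ⟨hx, -, hc⟩
    obtain rfl : c = 0 := by rw [← hx]; module
    refine ⟨?_, by module⟩
    linear_combination (norm := module) -hc
  · rintro ⟨hb, rfl⟩
    refine ⟨by module, ?_, ?_⟩
    · linear_combination (norm := module) -hb
    · linear_combination (norm := module) -hb

lemma determinant_twistedClosure_odd_false (j n : ℕ) :
    determinant (twistedClosure (2 * j + 1) (2 * n + 1) false) = 4 * n + 1 := by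
  refine determinant_twistedClosure_eq 0 (by lia) fun G _ cs b c => ?_
  rw [colored_fullTwists_odd_iff, colored_halfTwist_iff, colored_band_false_iff]
  push_cast
  refine and_congr_right fun _ => ⟨?_, ?_⟩
  · rintro ⟨hx, -, hc⟩
    obtain rfl : c = 0 := by rw [← hx]; module
    refine ⟨?_, by module⟩
    linear_combination (norm := module) hc
  · rintro ⟨hb, rfl⟩
    refine ⟨by module, ?_, ?_⟩
    · linear_combination (norm := module) hb
    · linear_combination (norm := module) hb

lemma determinant_twistedClosure_even_true (j n : ℕ) :
    determinant (twistedClosure (2 * j) (2 * n + 1) true) = 4 * n + 1 := by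
  refine determinant_twistedClosure_eq 2 (by lia) fun G _ cs b c => ?_
  rw [colored_fullTwists_even_iff, colored_halfTwist_iff, colored_band_true_iff]
  push_cast
  refine and_congr_right fun _ => ⟨?_, ?_⟩
  · rintro ⟨hx, hz, -⟩
    exact ⟨by linear_combination (norm := module) -hz, by linear_combination (norm := module) hx⟩
  · rintro ⟨hb, rfl⟩
    exact ⟨by module, by linear_combination (norm := module) -hb,
      by linear_combination (norm := module) -hb⟩

lemma determinant_twistedClosure_even_false (j n : ℕ) :
    determinant (twistedClosure (2 * j) (2 * n + 1) false) = 4 * n + 3 := by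
  refine determinant_twistedClosure_eq 2 (by lia) fun G _ cs b c => ?_
  rw [colored_fullTwists_even_iff, colored_halfTwist_iff, colored_band_false_iff]
  push_cast
  refine and_congr_right fun _ => ⟨?_, ?_⟩
  · rintro ⟨hx, hz, -⟩
    exact ⟨by linear_combination (norm := module) hz, by linear_combination (norm := module) hx⟩
  · rintro ⟨hb, rfl⟩
    exact ⟨by module, by linear_combination (norm := module) hb,
      by linear_combination (norm := module) hb⟩

lemma knotK_of_eq_add_one {n q k : ℕ} (h : q = 3 * k + 1) :
    knotK n q = twistedClosure k (2 * n + 1) true := by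
  rw [knotK, if_pos (by lia), show q / 3 = k by lia]

lemma knotK_of_eq_add_two {n q k : ℕ} (h : q = 3 * k + 2) :
    knotK n q = twistedClosure k (2 * n + 1) false := by
  rw [knotK, if_neg (by lia), show q / 3 = k by lia]

end KnotDiagram

end

theorem lemma4p1 (n q k : ℕ) (hq : 4 ≤ q) (hq3 : Nat.Coprime q 3) :
    (q = 3 * k + 1 → Odd k →
      KnotDiagram.determinant (KnotDiagram.knotK n q) = 4 * n + 3) ∧
    (q = 3 * k + 1 → Even k →
      KnotDiagram.determinant (KnotDiagram.knotK n q) = 4 * n + 1) ∧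
    (q = 3 * k + 2 → Odd k →
      KnotDiagram.determinant (KnotDiagram.knotK n q) = 4 * n + 1) ∧
    (q = 3 * k + 2 → Even k →
      KnotDiagram.determinant (KnotDiagram.knotK n q) = 4 * n + 3) := by
  refine ⟨fun h hk => ?_, fun h hk => ?_, fun h hk => ?_, fun h hk => ?_⟩
  · obtain ⟨j, rfl⟩ := hk
    rw [KnotDiagram.knotK_of_eq_add_one h, KnotDiagram.determinant_twistedClosure_odd_true]
  · obtain ⟨j, rfl⟩ := even_iff_two_dvd.mp hk
    rw [KnotDiagram.knotK_of_eq_add_one h, KnotDiagram.determinant_twistedClosure_even_true]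
  · obtain ⟨j, rfl⟩ := hk
    rw [KnotDiagram.knotK_of_eq_add_two h, KnotDiagram.determinant_twistedClosure_odd_false]
  · obtain ⟨j, rfl⟩ := even_iff_two_dvd.mp hk
    rw [KnotDiagram.knotK_of_eq_add_two h, KnotDiagram.determinant_twistedClosure_even_false]
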